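/- Let $F$ be a field of characteristic $\neq 2$ and let $A$ be a unital associative $F$-algebra that is zero-product balanced, i.e. for all $x,y,z \in A$ the element $xy \otimes z - x \otimes yz$ of $A \otimes_F A$ lies in the linear span of $\{v \otimes w : v,w \in A,\ vw = 0\}$. Write $[a,b] = ab - ba$, and for subsets $G, H \subseteq A$ let $[G,H]$ be the additive subgroup of $A$ generated by all $[g,h]$ with $g \in G$, $h \in H$. Let $V \subseteq A$ be an $F$-linear subspace that is fully noncentral, i.e. $[A,V]$ is not contained in any proper two-sided ideal of $A$. Then the following are equivalent: 1. $V$ is a Lie ideal, i.e. $[A,V] \subseteq V$. 2. $V$ is invariant under all inner automorphisms of $A$, i.e. $uVu^{-1} \subseteq V$ for every invertible $u \in A$. 3. $[A,A] \subseteq V$. -/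

import Mathlib

open scoped TensorProduct

namespace ZeroProductBalanced

/-- For subsets `G`, `H` of a ring, `[G, H]` is the additive subgroup generated by
the commutators `g * h - h * g` with `g ∈ G` and `h ∈ H`. -/
def commutatorSubgroup {A : Type*} [Ring A] (G H : Set A) : AddSubgroup A :=
  AddSubgroup.closure {c : A | ∃ g ∈ G, ∃ h ∈ H, c = g * h - h * g}

/-- A subset of a ring is full if it is not contained in a proper two-sided ideal. -/
def IsFull {A : Type*} [Ring A] (X : Set A) : Prop :=
  ∀ I : TwoSidedIdeal A, X ⊆ (I : Set A) → I = ⊤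

/-- A subset `X` of a ring `A` is fully noncentral if `[A, X]` is full. -/
def IsFullyNoncentral {A : Type*} [Ring A] (X : Set A) : Prop :=
  IsFull (commutatorSubgroup (Set.univ : Set A) X : Set A)

/-- An algebra `A` over `F` is zero-product balanced if, for all `x y z`, the tensor
`xy ⊗ z - x ⊗ yz` lies in the linear span of the tensors `v ⊗ w` with `v * w = 0`. -/
def IsZeroProductBalanced (F A : Type*) [Field F] [Ring A] [Algebra F A] : Prop :=
  ∀ x y z : A, (x * y) ⊗ₜ[F] z - x ⊗ₜ[F] (y * z) ∈
    Submodule.span F {t : A ⊗[F] A | ∃ v w : A, v * w = 0 ∧ t = v ⊗ₜ[F] w}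

/-- An automorphism of a unital algebra is inner if it is conjugation by a unit. -/
def IsInner {F A : Type*} [Field F] [Ring A] [Algebra F A] (α : A ≃ₐ[F] A) : Prop :=
  ∃ u : Aˣ, ∀ a : A, α a = (u : A) * a * ((u⁻¹ : Aˣ) : A)

/-- A subspace is invariant under all inner automorphisms if each of them maps it into itself. -/
def IsInnerInvariant {F A : Type*} [Field F] [Ring A] [Algebra F A]
    (V : Submodule F A) : Prop :=
  ∀ α : A ≃ₐ[F] A, IsInner α → ∀ a ∈ V, α a ∈ V

/-- A subspace `V` of an associative algebra `A` is a Lie ideal if `[A, V] ⊆ V`. -/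
def IsLieIdeal {F A : Type*} [Field F] [Ring A] [Algebra F A] (V : Submodule F A) : Prop :=
  (commutatorSubgroup (Set.univ : Set A) (V : Set A) : Set A) ⊆ (V : Set A)

end ZeroProductBalanced

namespace ZeroProductBalanced

attribute [local instance] LieRing.ofAssociativeRing

/-! ### Herstein-type identities in semiprime rings. -/

section Semiprime

variable {B : Type*} [Ring B]

/-! Conditions 1 and 2 each give [V, [A, A]] ⊆ V. For 2, zero-product balance makes commutators
combinations of elements n with n² = 0 (`IsZeroProductBalanced.lie_mem_span`), and conjugating v by
1 ± n and subtracting yields 2[v, n].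

`IsCommutatorNormalized.lie_mem` then gives [A, A] ⊆ V. Let T be the ring of x with [x, A] ⊆ V, U =
[V, V] and P = [U, U]. By Jacobi, U ⊆ T and [P, A] ⊆ T, so a[p, u] = [p, au] - [p, a]u puts A[P, U]
into T. The c with Ac ⊆ T form a two-sided ideal (`mul_mul_mem_of_normalized`). It contains [P, U],
which is full (`isFull_lie_lie_lie`): otherwise V would be central in a nonzero semiprime quotient.
Hence T = A. -/

theorem eq_zero_of_central_of_sq_eq_zero (hs : ∀ x : B, (∀ b, x * b * x = 0) → x = 0)
    {z : B} (hz : ∀ b, z * b = b * z) (h : z * z = 0) : z = 0 :=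
  hs z fun b => by rw [hz b, mul_assoc, h, mul_zero]

/-- If `d = [v, ·]` satisfies `d ∘ d = 0` on all commutators, then
`2 * da * db * da + 2 * d²a * b * da + da * b * d²a = 0`. -/
theorem lie_identity_left {v : B} (h : ∀ a b : B, ⁅v, ⁅v, ⁅a, b⁆⁆⁆ = 0) (a b : B) :
    2 * (⁅v, a⁆ * ⁅v, b⁆ * ⁅v, a⁆) + 2 * (⁅v, ⁅v, a⁆⁆ * b * ⁅v, a⁆)
      + ⁅v, a⁆ * b * ⁅v, ⁅v, a⁆⁆ = 0 := by
  have key : ∀ c : B, 2 * (⁅v, ⁅a, c⁆⁆ * ⁅v, a⁆) + ⁅a, c⁆ * ⁅v, ⁅v, a⁆⁆ = 0 := by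
    intro c
    have h1 := h a c
    have h2 := h a (c * a)
    -- Leibniz rule for d² on [a, ca] = [a, c]a.
    have : ⁅v, ⁅v, ⁅a, c * a⁆⁆⁆ = ⁅v, ⁅v, ⁅a, c⁆⁆⁆ * a
        + (2 * (⁅v, ⁅a, c⁆⁆ * ⁅v, a⁆) + ⁅a, c⁆ * ⁅v, ⁅v, a⁆⁆) := by
      simp only [Ring.lie_def]; noncomm_ring
    rwa [h2, h1, zero_mul, zero_add, eq_comm] at this
  have h1 := key b
  have h2 := key (v * b)
  have : 2 * (⁅v, ⁅a, v * b⁆⁆ * ⁅v, a⁆) + ⁅a, v * b⁆ * ⁅v, ⁅v, a⁆⁆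
      = v * (2 * (⁅v, ⁅a, b⁆⁆ * ⁅v, a⁆) + ⁅a, b⁆ * ⁅v, ⁅v, a⁆⁆)
        - (2 * (⁅v, a⁆ * ⁅v, b⁆ * ⁅v, a⁆) + 2 * (⁅v, ⁅v, a⁆⁆ * b * ⁅v, a⁆)
          + ⁅v, a⁆ * b * ⁅v, ⁅v, a⁆⁆) := by
    simp only [Ring.lie_def]; noncomm_ring
  rwa [h2, h1, mul_zero, zero_sub, eq_comm, neg_eq_zero] at this

/-- The mirror image of `lie_identity_left`. -/
theorem lie_identity_right {v : B} (h : ∀ a b : B, ⁅v, ⁅v, ⁅a, b⁆⁆⁆ = 0) (a b : B) :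
    2 * (⁅v, a⁆ * ⁅v, b⁆ * ⁅v, a⁆) + 2 * (⁅v, a⁆ * b * ⁅v, ⁅v, a⁆⁆)
      + ⁅v, ⁅v, a⁆⁆ * b * ⁅v, a⁆ = 0 := by
  have key : ∀ c : B, 2 * (⁅v, a⁆ * ⁅v, ⁅a, c⁆⁆) + ⁅v, ⁅v, a⁆⁆ * ⁅a, c⁆ = 0 := by
    intro c
    have h1 := h a c
    have h2 := h a (a * c)
    have : ⁅v, ⁅v, ⁅a, a * c⁆⁆⁆ = a * ⁅v, ⁅v, ⁅a, c⁆⁆⁆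
        + (2 * (⁅v, a⁆ * ⁅v, ⁅a, c⁆⁆) + ⁅v, ⁅v, a⁆⁆ * ⁅a, c⁆) := by
      simp only [Ring.lie_def]; noncomm_ring
    rwa [h2, h1, mul_zero, zero_add, eq_comm] at this
  have h1 := key b
  have h2 := key (b * v)
  have : 2 * (⁅v, a⁆ * ⁅v, ⁅a, b * v⁆⁆) + ⁅v, ⁅v, a⁆⁆ * ⁅a, b * v⁆
      = (2 * (⁅v, a⁆ * ⁅v, ⁅a, b⁆⁆) + ⁅v, ⁅v, a⁆⁆ * ⁅a, b⁆) * v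
        - (2 * (⁅v, a⁆ * ⁅v, b⁆ * ⁅v, a⁆) + 2 * (⁅v, a⁆ * b * ⁅v, ⁅v, a⁆⁆)
          + ⁅v, ⁅v, a⁆⁆ * b * ⁅v, a⁆) := by
    simp only [Ring.lie_def]; noncomm_ring
  rwa [h2, h1, zero_mul, zero_sub, eq_comm, neg_eq_zero] at this

/-- In a semiprime ring with `1/2`, an element `v` with `[v, [v, [B, B]]] = 0` is central. -/
theorem lie_eq_zero_of_lie_lie_commutator_eq_zero
    (hs : ∀ x : B, (∀ b, x * b * x = 0) → x = 0) (h2 : IsUnit (2 : B))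
    {v : B} (h : ∀ a b : B, ⁅v, ⁅v, ⁅a, b⁆⁆⁆ = 0) (a : B) : ⁅v, a⁆ = 0 := by
  have comm : ∀ a b : B, ⁅v, a⁆ * b * ⁅v, ⁅v, a⁆⁆ = ⁅v, ⁅v, a⁆⁆ * b * ⁅v, a⁆ := by
    intro a b
    have e1 := lie_identity_left h a b
    have e2 := lie_identity_right h a b
    rw [← e1] at e2
    rw [← sub_eq_zero] at e2 ⊢
    rw [← e2]; noncomm_ring
  have sq : ∀ a : B, ⁅v, ⁅v, a⁆⁆ = 0 := by
    intro a
    refine hs _ fun b => ?_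
    have e1 := comm a b
    have e2 := comm a (v * b)
    have e3 : ⁅v, ⁅v, ⁅v, a⁆⁆⁆ = 0 := h v a
    -- Comparing `comm` at vb with v times `comm` at b leaves d²a·b·d²a = d³a·b·da, and d³a = d²[v,
    -- a] = 0.
    have : ⁅v, ⁅v, a⁆⁆ * b * ⁅v, ⁅v, a⁆⁆
        = ⁅v, ⁅v, ⁅v, a⁆⁆⁆ * b * ⁅v, a⁆
          + v * (⁅v, a⁆ * b * ⁅v, ⁅v, a⁆⁆ - ⁅v, ⁅v, a⁆⁆ * b * ⁅v, a⁆)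
          - (⁅v, a⁆ * (v * b) * ⁅v, ⁅v, a⁆⁆ - ⁅v, ⁅v, a⁆⁆ * (v * b) * ⁅v, a⁆) := by
      simp only [Ring.lie_def]; noncomm_ring
    rw [this, e1, e2, e3]; simp
  have mul0 : ∀ a b : B, ⁅v, a⁆ * ⁅v, b⁆ = 0 := by
    intro a b
    have e : 2 * (⁅v, a⁆ * ⁅v, b⁆)
        = ⁅v, ⁅v, a * b⁆⁆ - ⁅v, ⁅v, a⁆⁆ * b - a * ⁅v, ⁅v, b⁆⁆ := by
      simp only [Ring.lie_def]; noncomm_ring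
    rw [sq, sq, sq, zero_mul, mul_zero, sub_zero, sub_zero] at e
    exact h2.mul_right_eq_zero.1 e
  refine hs _ fun b => ?_
  have e : ⁅v, a⁆ * b * ⁅v, a⁆ = ⁅v, a⁆ * ⁅v, b * a⁆ - ⁅v, a⁆ * ⁅v, b⁆ * a := by
    simp only [Ring.lie_def]; noncomm_ring
  rw [e, mul0, mul0, zero_mul, sub_zero]

end Semiprime

/-! ### Subgroups normalized by commutators. -/

section Commutators

variable {B : Type*} [Ring B]

theorem lie_mem_commutatorSubgroup {G H : Set B} {g h : B} (hg : g ∈ G) (hh : h ∈ H) :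
    ⁅g, h⁆ ∈ commutatorSubgroup G H :=
  AddSubgroup.subset_closure ⟨g, hg, h, hh, Ring.lie_def g h⟩

theorem commutatorSubgroup_le {G H : Set B} {W : AddSubgroup B}
    (h : ∀ g ∈ G, ∀ h ∈ H, ⁅g, h⁆ ∈ W) : commutatorSubgroup G H ≤ W := by
  refine (AddSubgroup.closure_le _).2 ?_
  rintro _ ⟨g, hg, k, hk, rfl⟩
  rw [← Ring.lie_def]
  exact h g hg k hk

/-- A subgroup `V` is normalized by commutators if `[V, [B, B]] ⊆ V`. -/
def IsCommutatorNormalized (V : AddSubgroup B) : Prop :=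
  ∀ x ∈ V, ∀ a b : B, ⁅x, ⁅a, b⁆⁆ ∈ V

theorem IsCommutatorNormalized.lie_self {V : AddSubgroup B} (hV : IsCommutatorNormalized V) :
    IsCommutatorNormalized (commutatorSubgroup (V : Set B) (V : Set B)) := by
  intro x hx a b
  induction hx using AddSubgroup.closure_induction with
  | mem x hx =>
    obtain ⟨g, hg, h, hh, rfl⟩ := hx
    rw [← Ring.lie_def, lie_lie, sub_eq_add_neg, lie_skew]
    exact add_mem (lie_mem_commutatorSubgroup hg (hV h hh a b))
      (lie_mem_commutatorSubgroup (hV g hg a b) hh)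
  | zero => simp
  | add x y _ _ hx hy => rw [add_lie]; exact add_mem hx hy
  | neg x _ hx => rw [neg_lie]; exact neg_mem hx

theorem IsCommutatorNormalized.map {C : Type*} [Ring C] {V : AddSubgroup B}
    (hV : IsCommutatorNormalized V) {f : B →+* C} (hf : Function.Surjective f) :
    IsCommutatorNormalized (V.map f.toAddMonoidHom) := by
  rintro _ ⟨x, hx, rfl⟩ a b
  obtain ⟨a, rfl⟩ := hf a
  obtain ⟨b, rfl⟩ := hf b
  exact ⟨_, hV x hx a b, by simp [Ring.lie_def]⟩

theorem IsCommutatorNormalized.lie_lie_self_le {V : AddSubgroup B}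
    (hV : IsCommutatorNormalized V) :
    commutatorSubgroup (commutatorSubgroup (V : Set B) (V : Set B) : Set B)
      (commutatorSubgroup (V : Set B) (V : Set B) : Set B)
      ≤ commutatorSubgroup (V : Set B) (V : Set B) := by
  refine commutatorSubgroup_le fun g hg h hh => ?_
  induction hh using AddSubgroup.closure_induction with
  | mem x hx =>
    obtain ⟨x, -, y, -, rfl⟩ := hx
    rw [← Ring.lie_def]
    exact hV.lie_self g hg x y
  | zero => simp
  | add x y _ _ hx hy => rw [lie_add]; exact add_mem hx hy
  | neg x _ hx => rw [lie_neg]; exact neg_mem hx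

/-- In a semiprime ring with `1/2`, a commutative subgroup normalized by commutators is
central. -/
theorem IsCommutatorNormalized.central_of_abelian
    (hs : ∀ x : B, (∀ b, x * b * x = 0) → x = 0) (h2 : IsUnit (2 : B))
    {V : AddSubgroup B} (hV : IsCommutatorNormalized V)
    (h : ∀ v ∈ V, ∀ w ∈ V, ⁅v, w⁆ = 0) : ∀ v ∈ V, ∀ a : B, ⁅v, a⁆ = 0 :=
  fun v hv => lie_eq_zero_of_lie_lie_commutator_eq_zero hs h2 fun a b => h v hv _ (hV v hv a b)

/-- In a semiprime ring with `1/2`, a subgroup `V` that is normalized by commutators and has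
central `[V, V]` is central. -/
theorem IsCommutatorNormalized.central_of_lie_central
    (hs : ∀ x : B, (∀ b, x * b * x = 0) → x = 0) (h2 : IsUnit (2 : B))
    {V : AddSubgroup B} (hV : IsCommutatorNormalized V)
    (h : ∀ v ∈ V, ∀ w ∈ V, ∀ a : B, ⁅⁅v, w⁆, a⁆ = 0) : ∀ v ∈ V, ∀ a : B, ⁅v, a⁆ = 0 := by
  refine hV.central_of_abelian hs h2 fun v hv w hw => ?_
  have hz : ∀ a, ⁅v, w⁆ * a = a * ⁅v, w⁆ := fun a => sub_eq_zero.1 (h v hv w hw a)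
  -- With z = [v, w] central, [[v, [v, [w, v²w²]]], w] = -4z⁴, so z is nilpotent.
  have e := h v hv _ (hV v hv w (v * v * (w * w))) w
  have hvw : v * w = w * v + ⁅v, w⁆ := by rw [Ring.lie_def]; abel
  generalize ⁅v, w⁆ = z at *
  have hvw' : ∀ x, v * (w * x) = w * (v * x) + z * x := fun x => by
    rw [← mul_assoc, hvw]; noncomm_ring
  have hz' : ∀ a x, a * (z * x) = z * (a * x) := fun a x => by
    rw [← mul_assoc, ← hz, mul_assoc]
  have e4 : 2 * (2 * (z * z * (z * z))) = 0 := by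
    rw [← neg_eq_zero, ← e]
    simp only [Ring.lie_def, mul_assoc, mul_sub, sub_mul, mul_add, add_mul, hvw, hvw',
      ← hz v, ← hz w, hz' v, hz' w]
    noncomm_ring
  have e5 := h2.mul_right_eq_zero.1 (h2.mul_right_eq_zero.1 e4)
  have e6 := eq_zero_of_central_of_sq_eq_zero hs
    (fun b => by rw [mul_assoc, hz, ← mul_assoc, hz, mul_assoc]) e5
  exact eq_zero_of_central_of_sq_eq_zero hs hz e6

/-- Since P = [U, U] ⊆ U, P is abelian, hence central; centrality then climbs from P to U = [V, V]
and to V. -/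
theorem IsCommutatorNormalized.central_of_lie_lie_lie_eq_zero
    (hs : ∀ x : B, (∀ b, x * b * x = 0) → x = 0) (h2 : IsUnit (2 : B))
    {V : AddSubgroup B} (hV : IsCommutatorNormalized V)
    (h : ∀ p ∈ commutatorSubgroup (commutatorSubgroup (V : Set B) (V : Set B) : Set B)
      (commutatorSubgroup (V : Set B) (V : Set B) : Set B),
      ∀ u ∈ commutatorSubgroup (V : Set B) (V : Set B), ⁅p, u⁆ = 0) :
    ∀ v ∈ V, ∀ a : B, ⁅v, a⁆ = 0 := by
  have hP := hV.lie_self.lie_self.central_of_abelian hs h2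
    fun p hp q hq => h p hp q (hV.lie_lie_self_le hq)
  have hU := hV.lie_self.central_of_lie_central hs h2
    fun v hv w hw => hP _ (lie_mem_commutatorSubgroup hv hw)
  exact hV.central_of_lie_central hs h2 fun v hv w hw => hU _ (lie_mem_commutatorSubgroup hv hw)

end Commutators

/-! ### Fullness tested in semiprime quotients. -/

section Quotients

universe u

variable {A : Type u} [Ring A]

theorem exists_maximal_twoSidedIdeal (I : TwoSidedIdeal A) (hI : I ≠ ⊤) :
    ∃ M : TwoSidedIdeal A, I ≤ M ∧ (1 : A) ∉ M ∧ ∀ J, M ≤ J → (1 : A) ∉ J → J = M := by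
  obtain ⟨M, hIM, hM⟩ := zorn_le_nonempty₀ {J : TwoSidedIdeal A | (1 : A) ∉ J} (by
    intro c hc hch J hJ
    have dir : ∀ X ∈ c, ∀ Y ∈ c, ∃ Z ∈ c, X ≤ Z ∧ Y ≤ Z := fun X hX Y hY =>
      hch.directedOn X hX Y hY
    refine ⟨TwoSidedIdeal.mk' {x | ∃ X ∈ c, x ∈ X} ⟨J, hJ, J.zero_mem⟩ ?_ ?_ ?_ ?_, ?_, ?_⟩
    · rintro x y ⟨X, hX, hx⟩ ⟨Y, hY, hy⟩
      obtain ⟨Z, hZ, h1, h2⟩ := dir X hX Y hY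
      exact ⟨Z, hZ, Z.add_mem (h1 hx) (h2 hy)⟩
    · rintro x ⟨X, hX, hx⟩
      exact ⟨X, hX, X.neg_mem hx⟩
    · rintro x y ⟨X, hX, hx⟩
      exact ⟨X, hX, X.mul_mem_left _ _ hx⟩
    · rintro x y ⟨X, hX, hx⟩
      exact ⟨X, hX, X.mul_mem_right _ _ hx⟩
    · simp only [Set.mem_ofPred_eq, TwoSidedIdeal.mem_mk']
      rintro ⟨X, hX, hx⟩
      exact hc hX hx
    · intro X hX x hx
      rw [TwoSidedIdeal.mem_mk']
      exact ⟨X, hX, hx⟩) I (fun h => hI (I.one_mem_iff.1 h))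
  exact ⟨M, hIM, hM.prop, fun J hMJ hJ => le_antisymm (hM.le_of_ge hJ hMJ) hMJ⟩

/-- A subset of a unital ring that is not full vanishes in a nonzero semiprime quotient. -/
theorem exists_semiprime_quotient {X : Set A} (hX : ¬ IsFull X) :
    ∃ (B : Type u) (_ : Ring B) (f : A →+* B), Function.Surjective f ∧ (1 : B) ≠ 0 ∧
      (∀ x : B, (∀ b, x * b * x = 0) → x = 0) ∧ ∀ x ∈ X, f x = 0 := by
  simp only [IsFull, not_forall] at hX
  obtain ⟨I, hXI, hI⟩ := hX
  obtain ⟨M, hIM, h1, hM⟩ := exists_maximal_twoSidedIdeal I hI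
  have hker : ∀ x, M.ringCon.mk' x = 0 ↔ x ∈ M := fun x => by
    rw [← TwoSidedIdeal.mem_ker, TwoSidedIdeal.ker_ringCon_mk']
  refine ⟨M.ringCon.Quotient, inferInstance, M.ringCon.mk', M.ringCon.mk'_surjective, ?_, ?_, ?_⟩
  · rw [← map_one M.ringCon.mk', Ne, hker]
    exact h1
  · intro x hx
    obtain ⟨x, rfl⟩ := M.ringCon.mk'_surjective x
    have hx' : ∀ b, x * b * x ∈ M := fun b => by
      rw [← hker, map_mul, map_mul]
      exact hx _
    rw [hker]
    by_contra hxM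
    -- An ideal containing M and x; it omits 1 because x ∉ M, against maximality of M.
    let Q : TwoSidedIdeal A := TwoSidedIdeal.mk' {y | ∀ b, x * b * y ∈ M}
      (fun b => by simp [M.zero_mem])
      (fun h h' b => by rw [mul_add]; exact M.add_mem (h b) (h' b))
      (fun h b => by rw [mul_neg]; exact M.neg_mem (h b))
      (fun {y z} h b => by rw [← mul_assoc, mul_assoc x]; exact h _)
      (fun {y z} h b => by rw [← mul_assoc]; exact M.mul_mem_right _ _ (h b))
    have hQ : ∀ y, y ∈ Q ↔ ∀ b, x * b * y ∈ M := fun y => TwoSidedIdeal.mem_mk' ..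
    have hMQ : M ≤ Q := fun y hy => (hQ y).2 fun b => M.mul_mem_left _ _ hy
    have h1Q : (1 : A) ∉ Q := fun h => hxM (by simpa using (hQ 1).1 h 1)
    have hxQ : x ∈ Q := (hQ x).2 hx'
    rw [hM Q hMQ h1Q] at hxQ
    exact hxM hxQ
  · intro x hx
    rw [hker]
    exact hIM (hXI hx)

theorem eq_zero_of_isFull {B : Type*} [Ring B] {X : Set A} (hX : IsFull X) (f : A →+* B)
    (h : ∀ x ∈ X, f x = 0) : (1 : B) = 0 := by
  have := hX (TwoSidedIdeal.ker f) fun x hx => (TwoSidedIdeal.mem_ker f).2 (h x hx)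
  rw [← map_one f, ← TwoSidedIdeal.mem_ker, this]
  exact TwoSidedIdeal.mem_top _

theorem IsFullyNoncentral.one_eq_zero {B : Type*} [Ring B] {V : AddSubgroup A}
    (hV : IsFullyNoncentral (V : Set A)) (f : A →+* B)
    (h : ∀ v ∈ V, ∀ a, ⁅f v, f a⁆ = 0) : (1 : B) = 0 := by
  refine eq_zero_of_isFull hV f fun x hx => ?_
  suffices commutatorSubgroup Set.univ (V : Set A) ≤ f.toAddMonoidHom.ker from this hx
  refine commutatorSubgroup_le fun a _ v hv => ?_
  have := h v hv a
  rw [← lie_skew, neg_eq_zero] at this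
  simpa [AddMonoidHom.mem_ker, Ring.lie_def] using this

theorem isFull_lie_lie_lie (h2 : IsUnit (2 : A)) {V : AddSubgroup A}
    (hV : IsCommutatorNormalized V) (hf : IsFullyNoncentral (V : Set A)) :
    IsFull {c : A | ∃ p ∈ commutatorSubgroup (commutatorSubgroup (V : Set A) (V : Set A) : Set A)
      (commutatorSubgroup (V : Set A) (V : Set A) : Set A),
      ∃ u ∈ commutatorSubgroup (V : Set A) (V : Set A), c = ⁅p, u⁆} := by
  by_contra hX
  obtain ⟨B, _, f, hsurj, h1, hs, h0⟩ := exists_semiprime_quotient hX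
  have h2B : IsUnit (2 : B) := by have := h2.map f; rwa [map_ofNat] at this
  have map_le : ∀ {G H : AddSubgroup A} {G' H' : AddSubgroup B},
      G' ≤ G.map f.toAddMonoidHom → H' ≤ H.map f.toAddMonoidHom →
      commutatorSubgroup (G' : Set B) (H' : Set B)
        ≤ (commutatorSubgroup (G : Set A) (H : Set A)).map f.toAddMonoidHom := by
    intro G H G' H' hG hH
    refine commutatorSubgroup_le fun g hg h hh => ?_
    obtain ⟨g, hg', rfl⟩ := hG hg
    obtain ⟨h, hh', rfl⟩ := hH hh
    exact ⟨_, lie_mem_commutatorSubgroup hg' hh', by simp [Ring.lie_def]⟩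
  have hc := (hV.map hsurj).central_of_lie_lie_lie_eq_zero hs h2B (by
    intro p hp u hu
    have hU := map_le (le_refl (V.map f.toAddMonoidHom)) (le_refl (V.map f.toAddMonoidHom))
    obtain ⟨p, hp', rfl⟩ := map_le hU hU hp
    obtain ⟨u, hu', rfl⟩ := hU hu
    simpa [Ring.lie_def] using h0 _ ⟨p, hp', u, hu', rfl⟩)
  exact h1 (hf.one_eq_zero f fun v hv a => hc _ ⟨v, hv, rfl⟩ (f a))

/-- In a semiprime quotient where commutators commute, they are central; then every element is
central, which full noncentrality forbids. -/
theorem isFull_lie_commutators (h2 : IsUnit (2 : A)) {V : AddSubgroup A}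
    (hf : IsFullyNoncentral (V : Set A)) :
    IsFull {x : A | ∃ a b c d : A, x = ⁅⁅a, b⁆, ⁅c, d⁆⁆} := by
  by_contra hX
  obtain ⟨B, _, f, hsurj, h1, hs, h0⟩ := exists_semiprime_quotient hX
  have h2B : IsUnit (2 : B) := by have := h2.map f; rwa [map_ofNat] at this
  have h0B : ∀ a b c d : B, ⁅⁅a, b⁆, ⁅c, d⁆⁆ = 0 := by
    intro a b c d
    obtain ⟨a, rfl⟩ := hsurj a
    obtain ⟨b, rfl⟩ := hsurj b
    obtain ⟨c, rfl⟩ := hsurj c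
    obtain ⟨d, rfl⟩ := hsurj d
    simpa [Ring.lie_def] using h0 _ ⟨a, b, c, d, rfl⟩
  have hK : ∀ a b x : B, ⁅⁅a, b⁆, x⁆ = 0 := fun a b =>
    lie_eq_zero_of_lie_lie_commutator_eq_zero hs h2B fun c d => by rw [h0B]
  have hB : ∀ x y : B, ⁅x, y⁆ = 0 := fun x =>
    lie_eq_zero_of_lie_lie_commutator_eq_zero hs h2B fun c d => by
      rw [← lie_skew x, hK, neg_zero]
  exact h1 (hf.one_eq_zero f fun v _ a => hB _ _)

end Quotients

/-! ### From normalization by commutators to containing them. -/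

section Main

variable {A : Type*} [Ring A]

/-- The elements `x` with `[x, A] ⊆ V` form a subring. -/
def lieTransporter (V : AddSubgroup A) : Subring A where
  carrier := {x | ∀ a, ⁅x, a⁆ ∈ V}
  mul_mem' {x y} hx hy a := by
    have e : ⁅x * y, a⁆ = ⁅x, y * a⁆ + ⁅y, a * x⁆ := by simp only [Ring.lie_def]; noncomm_ring
    rw [e]
    exact add_mem (hx _) (hy _)
  one_mem' a := by simp [Ring.lie_def]
  add_mem' hx hy a := by rw [add_lie]; exact add_mem (hx a) (hy a)
  zero_mem' a := by simp
  neg_mem' hx a := by rw [neg_lie]; exact neg_mem (hx a)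

/-- If `V` is normalized by commutators, so is the ring of all `x` with `[x, A] ⊆ V`. -/
theorem IsCommutatorNormalized.lieTransporter {V : AddSubgroup A}
    (hV : IsCommutatorNormalized V) :
    IsCommutatorNormalized (lieTransporter V).toAddSubgroup := by
  intro x hx a b c
  rw [lie_lie, sub_eq_add_neg, lie_skew]
  exact add_mem (hx _) (hV _ (hx c) a b)

/-- A subring that is normalized by commutators contains, for every `c` with `A * c` inside it,
the whole ideal generated by `c`, provided that `[[A, A], [A, A]]` is full. -/
theorem mul_mul_mem_of_normalized
    (hK : IsFull {x : A | ∃ a b c d : A, x = ⁅⁅a, b⁆, ⁅c, d⁆⁆}) {T : Subring A}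
    (hT : IsCommutatorNormalized T.toAddSubgroup) {c : A} (hc : ∀ a, a * c ∈ T) (r : A) :
    ∀ a, a * (c * r) ∈ T := by
  -- The right multipliers preserving {c | Ac ⊆ T}. This ring contains all commutators, so it
  -- contains the ideal generated by [[A, A], [A, A]].
  let R : Subring A :=
    { carrier := {r | ∀ c, (∀ a, a * c ∈ T) → ∀ a, a * (c * r) ∈ T}
      mul_mem' := fun {r s} hr hs c hc a => by
        rw [← mul_assoc c]
        exact hs _ (hr c hc) a
      one_mem' := fun c hc a => by rw [mul_one]; exact hc a
      add_mem' := fun hr hs c hc a => by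
        rw [mul_add, mul_add]; exact add_mem (hr c hc a) (hs c hc a)
      zero_mem' := fun c hc a => by simp
      neg_mem' := fun hr c hc a => by
        rw [mul_neg, mul_neg]; exact neg_mem (hr c hc a) }
  have hKR : ∀ x y : A, ⁅x, y⁆ ∈ R := by
    intro x y c hc a
    have e : a * (c * ⁅x, y⁆) = ⁅a * c, ⁅x, y⁆⁆ + ⁅x, y⁆ * a * c := by
      simp only [Ring.lie_def]; noncomm_ring
    rw [e]
    exact add_mem (hT _ (hc a) x y) (hc _)
  let Q : TwoSidedIdeal A := TwoSidedIdeal.mk' {y | ∀ a b, a * y * b ∈ R}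
    (fun a b => by simp)
    (fun h h' a b => by rw [mul_add, add_mul]; exact add_mem (h a b) (h' a b))
    (fun h a b => by rw [mul_neg, neg_mul]; exact neg_mem (h a b))
    (fun {y z} h a b => by rw [← mul_assoc]; exact h _ _)
    (fun {y z} h a b => by rw [← mul_assoc, mul_assoc _ z b]; exact h _ _)
  have hQ : ∀ y, y ∈ Q ↔ ∀ a b, a * y * b ∈ R := fun y => TwoSidedIdeal.mem_mk' ..
  have hQtop : Q = ⊤ := by
    refine hK Q ?_
    rintro _ ⟨x, y, z, w, rfl⟩
    refine (hQ _).2 fun a b => ?_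
    have e : a * ⁅⁅x, y⁆, ⁅z, w⁆⁆ * b = ⁅a * ⁅⁅x, y⁆, ⁅z, w⁆⁆, b⁆
        + (⁅⁅x, y⁆, b * a * ⁅z, w⁆⁆ - ⁅⁅x, y⁆, b * a⁆ * ⁅z, w⁆) := by
      simp only [Ring.lie_def]; noncomm_ring
    rw [e]
    exact add_mem (hKR _ _) (sub_mem (hKR _ _) (mul_mem (hKR _ _) (hKR _ _)))
  have hr : r ∈ R := by
    have h1 : (1 : A) ∈ Q := by rw [hQtop]; exact TwoSidedIdeal.mem_top _
    simpa using (hQ 1).1 h1 1 r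
  exact hr c hc

/-- In a unital ring with `1/2`, a fully noncentral subgroup that is normalized by `[A, A]`
contains `[A, A]`. -/
theorem IsCommutatorNormalized.lie_mem (h2 : IsUnit (2 : A)) {V : AddSubgroup A}
    (hV : IsCommutatorNormalized V) (hf : IsFullyNoncentral (V : Set A)) (x y : A) :
    ⁅x, y⁆ ∈ V := by
  have hT := hV.lieTransporter
  have hK := isFull_lie_commutators h2 hf
  have hUT : commutatorSubgroup (V : Set A) (V : Set A) ≤
      (ZeroProductBalanced.lieTransporter V).toAddSubgroup := by
    refine commutatorSubgroup_le fun v hv w hw a => ?_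
    rw [lie_lie, sub_eq_add_neg, lie_skew, ← lie_skew ⁅v, a⁆ w]
    exact add_mem (hV v hv w a) (neg_mem (hV w hw v a))
  have hPT : ∀ p ∈ commutatorSubgroup (commutatorSubgroup (V : Set A) (V : Set A) : Set A)
      (commutatorSubgroup (V : Set A) (V : Set A) : Set A), ∀ a,
      ⁅p, a⁆ ∈ ZeroProductBalanced.lieTransporter V := by
    intro p hp
    refine fun a => ?_
    induction hp using AddSubgroup.closure_induction with
    | mem p hp =>
      obtain ⟨u, hu, w, hw, rfl⟩ := hp
      rw [← Ring.lie_def, lie_lie, sub_eq_add_neg, lie_skew, ← lie_skew ⁅u, a⁆ w]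
      exact add_mem (hT u (hUT hu) w a) (neg_mem (hT w (hUT hw) u a))
    | zero => rw [zero_lie]; exact zero_mem _
    | add p q _ _ hp hq => rw [add_lie]; exact add_mem hp hq
    | neg p _ hp => rw [neg_lie]; exact neg_mem hp
  let J : TwoSidedIdeal A := TwoSidedIdeal.mk'
    {c | ∀ a, a * c ∈ ZeroProductBalanced.lieTransporter V}
    (fun a => by rw [mul_zero]; exact zero_mem _)
    (fun h h' a => by rw [mul_add]; exact add_mem (h a) (h' a))
    (fun h a => by rw [mul_neg]; exact neg_mem (h a))
    (fun {y z} h a => by rw [← mul_assoc]; exact h _)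
    (fun {y z} h => mul_mul_mem_of_normalized hK hT h z)
  have hJ : ∀ c, c ∈ J ↔ ∀ a, a * c ∈ ZeroProductBalanced.lieTransporter V :=
    fun c => TwoSidedIdeal.mem_mk' ..
  have hJtop : J = ⊤ := by
    refine isFull_lie_lie_lie h2 hV hf J ?_
    rintro _ ⟨p, hp, u, hu, rfl⟩
    refine (hJ _).2 fun a => ?_
    have e : a * ⁅p, u⁆ = ⁅p, a * u⁆ - ⁅p, a⁆ * u := by
      simp only [Ring.lie_def]; noncomm_ring
    rw [e]
    exact sub_mem (hPT p hp _) (mul_mem (hPT p hp _) (hUT hu))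
  have h1 : (1 : A) ∈ J := by rw [hJtop]; exact TwoSidedIdeal.mem_top _
  have hx : x ∈ ZeroProductBalanced.lieTransporter V := by simpa using (hJ 1).1 h1 x
  exact hx y

end Main

/-! ### Square-zero elements and inner automorphisms. -/

section Algebra

variable {F : Type*} {A : Type*} [Field F] [Ring A] [Algebra F A]

/-- In a zero-product balanced algebra every commutator is a linear combination of
elements of square zero. -/
theorem IsZeroProductBalanced.lie_mem_span (hA : IsZeroProductBalanced F A) (x y : A) :
    ⁅x, y⁆ ∈ Submodule.span F {n : A | n * n = 0} := by
  -- Reversed multiplication: if vw = 0 then (wv)² = 0, and y ⊗ x - 1 ⊗ yx maps to [x, y].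
  let m : A ⊗[F] A →ₗ[F] A := TensorProduct.lift (LinearMap.mul F A).flip
  have hm : ∀ a b : A, m (a ⊗ₜ[F] b) = b * a := fun a b => by simp [m]
  have key : ∀ t ∈ Submodule.span F {t : A ⊗[F] A | ∃ v w : A, v * w = 0 ∧ t = v ⊗ₜ[F] w},
      m t ∈ Submodule.span F {n : A | n * n = 0} := by
    intro t ht
    refine (Submodule.span_le (p := (Submodule.span F {n : A | n * n = 0}).comap m)).2 ?_ ht
    rintro _ ⟨v, w, hvw, rfl⟩
    refine Submodule.subset_span ?_
    rw [Set.mem_ofPred_eq, hm, mul_assoc, ← mul_assoc v, hvw, zero_mul, mul_zero]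
  have h := key _ (hA 1 y x)
  rwa [map_sub, hm, hm, one_mul, mul_one, ← Ring.lie_def] at h

/-- Conjugation by a unit, as an algebra automorphism. -/
def innerAut (F : Type*) {A : Type*} [Field F] [Ring A] [Algebra F A] (u : Aˣ) : A ≃ₐ[F] A :=
  AlgEquiv.ofLinearEquiv
    { toFun := fun a => (u : A) * a * ((u⁻¹ : Aˣ) : A)
      map_add' := fun a b => by rw [mul_add, add_mul]
      map_smul' := fun c a => by simp
      invFun := fun a => ((u⁻¹ : Aˣ) : A) * a * (u : A)
      left_inv := fun a => by simp [mul_assoc]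
      right_inv := fun a => by simp [mul_assoc] }
    (by simp) (fun a b => by simp [mul_assoc])

theorem IsInnerInvariant.conj_mem {V : Submodule F A} (hV : IsInnerInvariant V) (u : Aˣ)
    {a : A} (ha : a ∈ V) : (u : A) * a * ((u⁻¹ : Aˣ) : A) ∈ V :=
  hV (innerAut F u) ⟨u, fun _ => rfl⟩ a ha

theorem IsInnerInvariant.lie_mem_of_sq_eq_zero (h2 : (2 : F) ≠ 0) {V : Submodule F A}
    (hV : IsInnerInvariant V) {n v : A} (hn : n * n = 0) (hv : v ∈ V) : ⁅v, n⁆ ∈ V := by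
  let u : Aˣ := ⟨1 + n, 1 - n, by noncomm_ring; simp [hn], by noncomm_ring; simp [hn]⟩
  have h1 : (1 + n) * v * (1 - n) ∈ V := hV.conj_mem u hv
  have h3 : (1 - n) * v * (1 + n) ∈ V := by
    have := hV.conj_mem u⁻¹ hv
    rwa [inv_inv] at this
  have e : (2 : F) • ⁅v, n⁆ = (1 - n) * v * (1 + n) - (1 + n) * v * (1 - n) := by
    rw [two_smul, Ring.lie_def]; noncomm_ring
  rw [← V.smul_mem_iff h2, e]
  exact sub_mem h3 h1

theorem IsInnerInvariant.isCommutatorNormalized (hA : IsZeroProductBalanced F A)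
    (h2 : (2 : F) ≠ 0) {V : Submodule F A} (hV : IsInnerInvariant V) :
    IsCommutatorNormalized V.toAddSubgroup := by
  intro v hv a b
  have h := hA.lie_mem_span a b
  generalize ⁅a, b⁆ = k at h
  induction h using Submodule.span_induction with
  | mem n hn => exact hV.lie_mem_of_sq_eq_zero h2 hn hv
  | zero => simp
  | add x y _ _ hx hy => rw [lie_add]; exact add_mem hx hy
  | smul c x _ hx => rw [lie_smul]; exact V.smul_mem c hx

theorem IsLieIdeal.isCommutatorNormalized {V : Submodule F A} (hV : IsLieIdeal V) :
    IsCommutatorNormalized V.toAddSubgroup := by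
  intro v hv a b
  rw [← lie_skew]
  exact neg_mem (hV (lie_mem_commutatorSubgroup (Set.mem_univ _) hv))

theorem isLieIdeal_of_commutator_subset {V : Submodule F A}
    (hV : (commutatorSubgroup (Set.univ : Set A) (Set.univ : Set A) : Set A) ⊆ V) :
    IsLieIdeal V := by
  refine Set.Subset.trans ?_ hV
  exact commutatorSubgroup_le fun a _ v _ =>
    lie_mem_commutatorSubgroup (Set.mem_univ a) (Set.mem_univ v)

theorem isInnerInvariant_of_commutator_subset {V : Submodule F A}
    (hV : (commutatorSubgroup (Set.univ : Set A) (Set.univ : Set A) : Set A) ⊆ V) :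
    IsInnerInvariant V := by
  rintro α ⟨u, hu⟩ a ha
  have h := hV (lie_mem_commutatorSubgroup (Set.mem_univ ((u : A) * a))
    (Set.mem_univ ((u⁻¹ : Aˣ) : A)))
  have e : α a = ⁅(u : A) * a, ((u⁻¹ : Aˣ) : A)⁆ + a := by
    rw [hu, Ring.lie_def]; simp
  rw [e]
  exact add_mem h ha

end Algebra

end ZeroProductBalanced

open ZeroProductBalanced in
theorem ZeroProductBalanced.IsCommutatorNormalized.commutator_subset {F : Type*} {A : Type*}
    [Field F] [Ring A] [Algebra F A] (h2 : (2 : F) ≠ 0) {V : Submodule F A}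
    (hV : IsCommutatorNormalized V.toAddSubgroup) (hf : IsFullyNoncentral (V : Set A)) :
    (commutatorSubgroup (Set.univ : Set A) (Set.univ : Set A) : Set A) ⊆ V := by
  have h2A : IsUnit (2 : A) := by
    have := (IsUnit.mk0 (2 : F) h2).map (algebraMap F A)
    rwa [map_ofNat] at this
  exact commutatorSubgroup_le (W := V.toAddSubgroup) fun x _ y _ => hV.lie_mem h2A hf x y

theorem corollary5p8 {F : Type*} {A : Type*} [Field F] [Ring A] [Algebra F A]
    (hchar : ringChar F ≠ 2)
    (hA : ZeroProductBalanced.IsZeroProductBalanced F A)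
    (V : Submodule F A)
    (hV : ZeroProductBalanced.IsFullyNoncentral (V : Set A)) :
    List.TFAE [
      ZeroProductBalanced.IsLieIdeal V,
      ZeroProductBalanced.IsInnerInvariant V,
      (ZeroProductBalanced.commutatorSubgroup (Set.univ : Set A) (Set.univ : Set A) : Set A)
        ⊆ (V : Set A)] := by
  have h2 : (2 : F) ≠ 0 := Ring.two_ne_zero hchar
  tfae_have 1 → 3 := fun h => h.isCommutatorNormalized.commutator_subset h2 hV
  tfae_have 2 → 3 := fun h => (h.isCommutatorNormalized hA h2).commutator_subset h2 hV
  tfae_have 3 → 1 := ZeroProductBalanced.isLieIdeal_of_commutator_subset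
  tfae_have 3 → 2 := ZeroProductBalanced.isInnerInvariant_of_commutator_subset
  tfae_finish
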